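/- Let $d\ge 1$, $s>0$, $T>0$. For $\sigma>0$ let $(-\Delta)^{\sigma}$ be the Fourier multiplier with symbol $|\xi|^{2\sigma}$ on $L^2(\mathbb R^d)=L^2(\mathbb R^d;\mathbb C)$ (with the convention $\hat f(\xi)=\int e^{-ix\cdot\xi}f(x)\,dx$), and let $H^s(\mathbb R^d)=\{f\in L^2:(-\Delta)^{s/2}f\in L^2\}$ with norm $\|f\|_{L^2}+\|(-\Delta)^{s/2}f\|_{L^2}$. For real functions $m,b$, for $f:[0,T]\to L^2(\mathbb R^d)$ and data $u_0,u_1$, a (classical) solution of $$u_{tt}+(-\Delta)^s u+m(x)u+b(x)u_t=f(t,x)\ \text{ on }[0,T]\times\mathbb R^d,\qquad u(0)=u_0,\quad u_t(0)=u_1, \qquad (*)$$ means a function $u\in C([0,T];H^s(\mathbb R^d))\cap C^1([0,T];L^2(\mathbb R^d))$ with these initial values which satisfies the equation in the dual space $H^{-s}(\mathbb R^d)$ of $H^s(\mathbb R^d)$ for all $t\in[0,T]$, that is, $$\frac{d}{dt}\langle u_t,\varphi\rangle_{L^2}+\langle(-\Delta)^{s/2}u,(-\Delta)^{s/2}\varphi\rangle_{L^2}+\langle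 mu+bu_t,\varphi\rangle_{L^2}=\langle f,\varphi\rangle_{L^2}\qquad\text{for all }\varphi\in H^s(\mathbb R^d).$$ Let $\psi\in C_c^\infty(\mathbb R^d)$ with $\psi\ge0$, $\int\psi=1$ be a Friedrichs mollifier and $\psi_\varepsilon(x)=\varepsilon^{-d}\psi(x/\varepsilon)$ for $\varepsilon\in(0,1]$. **Theorem.** Let $m,b\in L^\infty(\mathbb R^d)$ be real-valued and non-negative, $f\in C([0,T];L^2(\mathbb R^d))$ (for instance $f\in L^2(\mathbb R^d)$ independent of $t$), $u_0\in H^s(\mathbb R^d)$, $u_1\in L^2(\mathbb R^d)$, and let $u$ be a classical solution of $(*)$. Put $m_\varepsilon=m*\psi_\varepsilon$, $b_\varepsilon=b*\psi_\varepsilon$, $f_\varepsilon(t,\cdot)=f(t,\cdot)*\psi_\varepsilon$, $u_{0,\varepsilon}=u_0*\psi_\varepsilon$, $u_{1,\varepsilon}=u_1*\psi_\varepsilon$, and assume that $\|m_\varepsilon-m\|_{L^\infty}\to0$ and $\|b_\varepsilon-b\|_{L^\infty}\to0$ as $\varepsilon\to0$. Let $(u_\varepsilon)_{\varepsilon\in(0,1]}$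 be a net such that, for every $\varepsilon\in(0,1]$, $u_\varepsilon\in C([0,T];H^s(\mathbb R^d))\cap C^1([0,T];L^2(\mathbb R^d))$ solves the regularised problem, that is, $(*)$ with $m_\varepsilon,b_\varepsilon,f_\varepsilon,u_{0,\varepsilon},u_{1,\varepsilon}$ in place of $m,b,f,u_0,u_1$ (in particular, let $(u_\varepsilon)_\varepsilon$ be a very weak solution of $(*)$ for these regularisations, which is such a net that in addition satisfies $\sup_{t\in[0,T]}(\|u_\varepsilon\|_{L^2}+\|(-\Delta)^{s/2}u_\varepsilon\|_{L^2}+\|\partial_tu_\varepsilon\|_{L^2})\le C\varepsilon^{-N}$ for some $C,N$). Then $$\sup_{t\in[0,T]}\|u_\varepsilon(t,\cdot)-u(t,\cdot)\|_{L^2(\mathbb R^d)}\longrightarrow0\qquad\text{as }\varepsilon\to0.$$ -/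

import Mathlib

open MeasureTheory Filter Topology Set
open scoped FourierTransform ContDiff ENNReal ComplexConjugate

namespace FracWave

noncomputable section

/-- The space `L²(ℝᵈ)` of (classes of) complex-valued square-integrable functions. -/
abbrev L2 (d : ℕ) : Type := Lp ℂ 2 (volume : Measure (EuclideanSpace ℝ (Fin d)))

/-- The symbol of `(-Δ)^σ`. The Fourier transform of Mathlib is
`𝓕 f ξ = ∫ exp (-2πi⟨x, ξ⟩) f x`, so the angular frequency is `2πξ` and the symbol, which is
`|η|^(2σ)` in the angular frequency `η`, is `(2π|ξ|)^(2σ)` here. -/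
def fracSymbol {d : ℕ} (σ : ℝ) (ξ : EuclideanSpace ℝ (Fin d)) : ℝ :=
  (2 * Real.pi * ‖ξ‖) ^ (2 * σ)

/-- `(-Δ)^σ f` belongs to `L²`, for `f` in `L²`. -/
def FracLapMemL2 {d : ℕ} (σ : ℝ) (f : L2 d) : Prop :=
  MemLp (fun ξ => (fracSymbol σ ξ : ℂ) * (𝓕 f : L2 d) ξ) 2 volume

open Classical in
/-- The fractional Laplacian `(-Δ)^σ f = 𝓕⁻¹ ((2π|ξ|)^(2σ) 𝓕 f)` as an (unbounded) operator
in `L²`. Outside its domain it takes the value `0`; it is only used on its domain. -/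
def fracLap {d : ℕ} (σ : ℝ) (f : L2 d) : L2 d :=
  if h : FracLapMemL2 σ f then 𝓕⁻ (h.toLp _ : L2 d) else 0

/-- The fractional Sobolev space `H^s = {f ∈ L² : (-Δ)^(s/2) f ∈ L²}`, whose norm is
`‖f‖_{L²} + ‖(-Δ)^(s/2) f‖_{L²}`. -/
def MemHs {d : ℕ} (s : ℝ) (f : L2 d) : Prop := FracLapMemL2 (s / 2) f

/-- A Friedrichs mollifier: smooth, compactly supported, non-negative, of integral one. -/
structure IsFriedrichsMollifier {d : ℕ} (ψ : EuclideanSpace ℝ (Fin d) → ℝ) : Prop where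
  contDiff : ContDiff ℝ ∞ ψ
  hasCompactSupport : HasCompactSupport ψ
  nonneg : ∀ x, 0 ≤ ψ x
  integral_eq_one : ∫ x, ψ x = 1

/-- `ψ_ε (x) = ε^(-d) ψ (x / ε)`. -/
def scaled {d : ℕ} (ψ : EuclideanSpace ℝ (Fin d) → ℝ) (ε : ℝ) :
    EuclideanSpace ℝ (Fin d) → ℝ :=
  fun x => (ε ^ d)⁻¹ * ψ (ε⁻¹ • x)

/-- The regularisation `g ∗ ψ_ε`, that is `x ↦ ∫ y, ψ_ε (y) g (x - y)`. -/
def mollify {d : ℕ} {F : Type*} [NormedAddCommGroup F] [NormedSpace ℝ F]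
    (ψ : EuclideanSpace ℝ (Fin d) → ℝ) (ε : ℝ) (g : EuclideanSpace ℝ (Fin d) → F) :
    EuclideanSpace ℝ (Fin d) → F :=
  convolution (scaled ψ ε) g (ContinuousLinearMap.lsmul ℝ ℝ) volume

/-- The time derivative `u_t` on `[0,T]` of an `L²`-valued function, one-sided at the ends. -/
def timeDeriv {d : ℕ} (T : ℝ) (u : ℝ → L2 d) (t : ℝ) : L2 d := derivWithin u (Icc 0 T) t

/-- `u ∈ C([0,T]; H^s) ∩ C¹([0,T]; L²)` solves the Cauchy problem
`u_tt + (-Δ)^s u + m u + b u_t = f`, `u(0) = u₀`, `u_t(0) = u₁` on `[0,T] × ℝᵈ`.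
In this class `u_tt` and `(-Δ)^s u` have values in the dual space `H^{-s}` of `H^s`, and the
equation is the equality in that space at every time `t ∈ [0,T]`: for every `φ ∈ H^s`,
`d/dt ⟨u_t, φ⟩ + ⟨(-Δ)^(s/2) u, (-Δ)^(s/2) φ⟩ + ⟨m u + b u_t, φ⟩ = ⟨f, φ⟩`.
(Mathlib's inner product is conjugate-linear in its first argument.) -/
structure IsSolution {d : ℕ} (T s : ℝ) (m b : EuclideanSpace ℝ (Fin d) → ℝ)
    (f : ℝ → EuclideanSpace ℝ (Fin d) → ℂ) (u₀ u₁ : EuclideanSpace ℝ (Fin d) → ℂ)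
    (u : ℝ → L2 d) : Prop where
  memHs : ∀ t ∈ Icc 0 T, MemHs s (u t)
  continuousOn : ContinuousOn u (Icc 0 T)
  continuousOn_fracLap : ContinuousOn (fun t => fracLap (s / 2) (u t)) (Icc 0 T)
  contDiffOn : ContDiffOn ℝ 1 u (Icc 0 T)
  initial : u 0 =ᵐ[volume] u₀
  initial_timeDeriv : timeDeriv T u 0 =ᵐ[volume] u₁
  equation : ∀ φ : L2 d, MemHs s φ → ∀ t ∈ Icc 0 T,
    HasDerivWithinAt (fun τ => inner ℂ φ (timeDeriv T u τ))
      ((∫ x, conj (φ x) * f t x)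
        - inner ℂ (fracLap (s / 2) φ) (fracLap (s / 2) (u t))
        - ∫ x, conj (φ x) * ((m x : ℂ) * u t x + (b x : ℂ) * timeDeriv T u t x))
      (Icc 0 T) t

end

end FracWave

/-!
The difference `w = u_ε - u` solves, with coefficients `m_ε`, `b_ε` and in the weak sense, the same
equation with the right-hand side `(f_ε - f) - (m_ε - m) u - (b_ε - b) u_t` and the initial data
`u₀ ∗ ψ_ε - u₀`, `u₁ ∗ ψ_ε - u₁`. All of these are small in `L²`, so it suffices to have an estimate
of `w` in `L²` by the `L²` norms of its data.

The velocity `w_t` is only in `L²` and cannot be used as a test function, which rules out the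
usual energy estimate without a further regularisation. Instead the equation is integrated once in
time: with `A = (-Δ)^(s/2)`, `V(t) = ∫₀ᵗ A w` and `W(t) = ∫₀ᵗ w`, it reads
`⟨φ, w_t(t)⟩ + ⟨A φ, V(t)⟩ + ⟨φ, m W(t) + b w(t)⟩ = ⟨φ, w_t(0) + b w(0)⟩ + ∫₀ᵗ ⟨φ, g⟩`, and
`φ = w(t) ∈ H^s` is now admissible. Since `V_t = A w`, the two terms with `A` cancel in
the derivative of `‖w‖² + ‖V‖² + ‖W‖²`, and Gronwall's inequality bounds `w` (`energy_estimate`).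
In it `m` and `b` enter as bounded operators on `L²`, and the initial displacement is measured in
`L²` rather than in `H^s`, so that the Fourier transform enters solely through the linearity
of `A` (`fracLap_sub`). Applied to two solutions it gives `IsSolution.norm_sub_sq_le`.

The convergence of the data is `eventually_eLpNorm_mollify_sub_le`: `v ∗ ψ_ε → v` in `L²`, uniformly
for `v` in a compact set, here `f([0,T]) ∪ {u₀, u₁}`. The density `ψ_ε` has mass one, so
`‖v ∗ ψ_ε - v‖` is at most the largest `‖v(· - y) - v‖` over the support of `ψ_ε`
(`eLpNorm_convolution_sub_le`), and translation is continuous on `L²`.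
-/

namespace FracWave

/-! ### The energy estimate in a Hilbert space -/

theorem exists_primitive_on_Icc {E : Type*} [NormedAddCommGroup E] [NormedSpace ℝ E]
    [CompleteSpace E] {T : ℝ} (hT : 0 ≤ T) {a : ℝ → E} (ha : ContinuousOn a (Icc 0 T)) :
    ∃ V : ℝ → E, V 0 = 0 ∧ ∀ t ∈ Icc 0 T, HasDerivWithinAt V (a t) (Icc 0 T) t := by
  have hc : Continuous (IccExtend hT ((Icc 0 T).domRestrict a)) :=
    (continuousOn_iff_continuous_domRestrict.1 ha).Icc_extend'
  refine ⟨fun t => ∫ τ in (0 : ℝ)..t, IccExtend hT ((Icc 0 T).domRestrict a) τ, by simp,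
    fun t ht => ?_⟩
  have h := (hc.integral_hasStrictDerivAt 0 t).hasDerivAt.hasDerivWithinAt (s := Icc 0 T)
  rwa [IccExtend_of_mem hT _ ht] at h

section Energy

variable {H : Type*} [NormedAddCommGroup H] [InnerProductSpace ℂ H] [NormedSpace ℝ H]

theorem hasDerivWithinAt_norm_sq {w : ℝ → H} {w' : H} {S : Set ℝ} {t : ℝ}
    (hw : HasDerivWithinAt w w' S t) :
    HasDerivWithinAt (fun τ => ‖w τ‖ ^ 2) (2 * (inner ℂ (w t) w').re) S t := by
  have h := Complex.reCLM.hasFDerivAt.comp_hasDerivWithinAt t (hw.inner ℂ hw)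
  have h1 : (inner ℂ w' (w t)).re = (inner ℂ (w t) w').re := inner_re_symm (𝕜 := ℂ) _ _
  have h2 : (fun τ => ‖w τ‖ ^ 2) = Complex.reCLM ∘ fun τ => inner ℂ (w τ) (w τ) :=
    funext fun τ => norm_sq_eq_re_inner (𝕜 := ℂ) (w τ)
  rw [h2]
  simpa [h1, two_mul] using h

/-- An estimate for weak solutions `w` of `w'' + A² w + M w + B w' = g` with `‖g‖ ≤ γ` by data
measured in the norm of `H` alone. The function `a` stands for `A w`, the complex number `z` for
the derivative of `⟨w r, w'⟩` at `t`. The equation is only tested with the values `w r` of the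
solution itself, so that neither `A` nor its domain appears. -/
theorem energy_estimate [CompleteSpace H] {T : ℝ} (hT : 0 ≤ T) {w w' a : ℝ → H}
    (hw : ∀ t ∈ Icc 0 T, HasDerivWithinAt w (w' t) (Icc 0 T) t)
    (ha : ContinuousOn a (Icc 0 T)) (M B : H →L[ℝ] H) {μ β γ : ℝ}
    (hM : ‖M‖ ≤ μ) (hB : ‖B‖ ≤ β)
    (heq : ∀ r ∈ Icc 0 T, ∀ t ∈ Icc 0 T, ∃ z : ℂ,
      HasDerivWithinAt (fun τ => inner ℂ (w r) (w' τ)) z (Icc 0 T) t ∧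
      ‖z + inner ℂ (a r) (a t) + inner ℂ (w r) (M (w t) + B (w' t))‖ ≤ γ * ‖w r‖)
    {t : ℝ} (ht : t ∈ Icc 0 T) :
    ‖w t‖ ^ 2 ≤ (‖w 0‖ ^ 2 + (γ * T + ‖w' 0‖ + β * ‖w 0‖) ^ 2)
      * Real.exp ((2 + μ + 2 * β) * T) := by
  have hμ : 0 ≤ μ := (norm_nonneg M).trans hM
  have hβ : 0 ≤ β := (norm_nonneg B).trans hB
  have h0 : (0 : ℝ) ∈ Icc 0 T := ⟨le_rfl, hT⟩
  have hwc : ContinuousOn w (Icc 0 T) := fun t ht => (hw t ht).continuousWithinAt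
  obtain ⟨V, hV0, hV⟩ := exists_primitive_on_Icc hT ha
  obtain ⟨W, hW0, hW⟩ := exists_primitive_on_Icc hT hwc
  set η : ℝ := γ * T + ‖w' 0‖ + β * ‖w 0‖ with hη
  have hMle : ∀ x, ‖M x‖ ≤ μ * ‖x‖ := fun x => M.le_of_opNorm_le hM x
  have hBle : ∀ x, ‖B x‖ ≤ β * ‖x‖ := fun x => B.le_of_opNorm_le hB x
  -- The equation integrated in time and tested with `w r`. As `g` need not be integrable in time,
  -- its contribution is bounded by the mean value inequality.
  have hint : ∀ r ∈ Icc 0 T, ∀ t ∈ Icc 0 T,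
      ‖inner ℂ (w r) (w' t) + inner ℂ (a r) (V t) + inner ℂ (w r) (M (W t) + B (w t))
        - (inner ℂ (w r) (w' 0) + inner ℂ (w r) (B (w 0)))‖ ≤ γ * T * ‖w r‖ := by
    intro r hr t ht
    let θ : ℝ → ℂ := fun τ => inner ℂ (w r) (w' τ) + inner ℂ (a r) (V τ)
      + inner ℂ (w r) (M (W τ) + B (w τ))
    choose! z hz1 hz2 using heq r hr
    have hθ : ∀ τ ∈ Icc 0 T, HasDerivWithinAt θ
        (z τ + inner ℂ (a r) (a τ) + inner ℂ (w r) (M (w τ) + B (w' τ))) (Icc 0 T) τ := by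
      intro τ hτ
      have h1 := (hasDerivWithinAt_const τ (Icc 0 T) (a r)).inner ℂ (hV τ hτ)
      have h2 := (hasDerivWithinAt_const τ (Icc 0 T) (w r)).inner ℂ
        ((M.hasFDerivAt.comp_hasDerivWithinAt τ (hW τ hτ)).add
          (B.hasFDerivAt.comp_hasDerivWithinAt τ (hw τ hτ)))
      simp only [inner_zero_left, add_zero] at h1 h2
      exact ((hz1 τ hτ).add h1).add h2
    have h := (convex_Icc (0 : ℝ) T).norm_image_sub_le_of_norm_hasDerivWithin_le hθ
      hz2 h0 ht
    have hθ0 : θ 0 = inner ℂ (w r) (w' 0) + inner ℂ (w r) (B (w 0)) := by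
      simp [θ, hV0, hW0]
    rw [hθ0, sub_zero, Real.norm_of_nonneg ht.1] at h
    have hγ : 0 ≤ γ * ‖w r‖ := (norm_nonneg _).trans (hz2 0 h0)
    calc _ ≤ γ * ‖w r‖ * t := h
      _ ≤ γ * ‖w r‖ * T := by gcongr; exact ht.2
      _ = γ * T * ‖w r‖ := by ring
  let F : ℝ → ℝ := fun τ => ‖w τ‖ ^ 2 + ‖V τ‖ ^ 2 + ‖W τ‖ ^ 2
  let F' : ℝ → ℝ := fun τ => 2 * (inner ℂ (w τ) (w' τ)).re + 2 * (inner ℂ (V τ) (a τ)).re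
    + 2 * (inner ℂ (W τ) (w τ)).re
  have hF : ∀ τ ∈ Icc 0 T, HasDerivWithinAt F (F' τ) (Icc 0 T) τ := fun τ hτ =>
    ((hasDerivWithinAt_norm_sq (hw τ hτ)).add (hasDerivWithinAt_norm_sq (hV τ hτ))).add
      (hasDerivWithinAt_norm_sq (hW τ hτ))
  -- Testing with `r = τ` cancels `Re ⟨V, a⟩` in `F'` against the principal part of the equation.
  have hbound : ∀ τ ∈ Ico 0 T, F' τ ≤ (2 + μ + 2 * β) * F τ + η ^ 2 := by
    intro τ hτ'
    have hτ : τ ∈ Icc 0 T := Ico_subset_Icc_self hτ'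
    have h1 := (Complex.re_le_norm _).trans (hint τ hτ τ hτ)
    have hre : ∀ x y : H, |(inner ℂ x y).re| ≤ ‖x‖ * ‖y‖ := fun x y =>
      (Complex.abs_re_le_norm _).trans (norm_inner_le_norm x y)
    have hsym : (inner ℂ (a τ) (V τ)).re = (inner ℂ (V τ) (a τ)).re :=
      inner_re_symm (𝕜 := ℂ) _ _
    simp only [Complex.add_re, Complex.sub_re, inner_add_right, hsym] at h1
    have h2 := (abs_le.1 (hre (w τ) (M (W τ)))).1
    have h3 := (abs_le.1 (hre (w τ) (B (w τ)))).1
    have h4 := (abs_le.1 (hre (w τ) (w' 0))).2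
    have h5 := (abs_le.1 (hre (w τ) (B (w 0)))).2
    have h6 := (abs_le.1 (hre (W τ) (w τ))).2
    have k2 := mul_le_mul_of_nonneg_left (hMle (W τ)) (norm_nonneg (w τ))
    have k3 := mul_le_mul_of_nonneg_left (hBle (w τ)) (norm_nonneg (w τ))
    have k5 := mul_le_mul_of_nonneg_left (hBle (w 0)) (norm_nonneg (w τ))
    have e1 : 2 * ‖w τ‖ * η ≤ ‖w τ‖ ^ 2 + η ^ 2 := two_mul_le_add_sq _ _
    have e2 : 2 * ‖w τ‖ * ‖W τ‖ ≤ ‖w τ‖ ^ 2 + ‖W τ‖ ^ 2 := two_mul_le_add_sq _ _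
    have e3 := mul_le_mul_of_nonneg_left e2 hμ
    have e4 : 0 ≤ (2 + μ + 2 * β) * ‖V τ‖ ^ 2 := by positivity
    have e5 : 0 ≤ (1 + 2 * β) * ‖W τ‖ ^ 2 := by positivity
    simp only [F, F']
    rw [hη] at e1 ⊢
    nlinarith
  have hG := le_gronwallBound_of_liminf_deriv_right_le (f := F) (f' := F') (δ := ‖w 0‖ ^ 2)
    (fun τ hτ => (hF τ hτ).continuousWithinAt)
    (fun τ hτ r hr => ((hF τ (Ico_subset_Icc_self hτ)).mono_of_mem_nhdsWithin
      (Icc_mem_nhdsGE_of_mem hτ)).liminf_right_slope_le hr) (by simp [F, hV0, hW0]) hbound t ht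
  have hK : 1 ≤ 2 + μ + 2 * β := by linarith
  rw [gronwallBound_of_K_ne_0 (by positivity)] at hG
  have hexp : Real.exp ((2 + μ + 2 * β) * (t - 0)) ≤ Real.exp ((2 + μ + 2 * β) * T) := by
    rw [sub_zero]; gcongr; exact ht.2
  calc ‖w t‖ ^ 2 ≤ F t := by simp only [F]; nlinarith [sq_nonneg ‖V t‖, sq_nonneg ‖W t‖]
    _ ≤ _ := hG
    _ ≤ ‖w 0‖ ^ 2 * Real.exp ((2 + μ + 2 * β) * (t - 0))
        + η ^ 2 * Real.exp ((2 + μ + 2 * β) * (t - 0)) := by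
      refine add_le_add le_rfl (mul_le_mul (div_le_self (sq_nonneg _) hK) ?_ ?_ (sq_nonneg _))
      · linarith
      · have := Real.one_le_exp (x := (2 + μ + 2 * β) * (t - 0))
          (mul_nonneg (by positivity) (by linarith [ht.1]))
        linarith
    _ ≤ _ := by rw [← add_mul]; gcongr

end Energy

/-! ### Mollification in `L²` -/

theorem eLpNorm_two_sq {α F : Type*} [MeasurableSpace α] [NormedAddCommGroup F]
    (f : α → F) (μ : Measure α) : eLpNorm f 2 μ ^ 2 = ∫⁻ x, ‖f x‖ₑ ^ 2 ∂μ := by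
  have h := eLpNorm_nnreal_pow_eq_lintegral (f := f) (μ := μ) (p := 2) two_ne_zero
  simpa using h

/-- The Cauchy–Schwarz inequality `|∫ h dν|² ≤ ∫ |h|² dν` for the probability measure `ν` of
density `φ`. -/
theorem enorm_integral_density_smul_sq_le {α F : Type*} [MeasurableSpace α]
    [NormedAddCommGroup F] [NormedSpace ℝ F] {μ : Measure α} {φ : α → ℝ} {h : α → F}
    (hφ : Measurable φ) (hφ0 : ∀ y, 0 ≤ φ y) (hφi : Integrable φ μ) (hφ1 : ∫ y, φ y ∂μ = 1)
    (hh : AEStronglyMeasurable h μ) :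
    ‖∫ y, φ y • h y ∂μ‖ₑ ^ 2 ≤ ∫⁻ y, ENNReal.ofReal (φ y) * ‖h y‖ₑ ^ 2 ∂μ := by
  set ν := μ.withDensity fun y => ENNReal.ofReal (φ y) with hν
  have hρ : Measurable fun y => ENNReal.ofReal (φ y) := hφ.ennreal_ofReal
  have hprob : IsProbabilityMeasure ν := ⟨by
    rw [hν, withDensity_apply _ MeasurableSet.univ, Measure.restrict_univ,
      ← ofReal_integral_eq_lintegral_ofReal hφi (ae_of_all _ hφ0), hφ1, ENNReal.ofReal_one]⟩
  have hhν : AEStronglyMeasurable h ν := hh.mono_ac (withDensity_absolutelyContinuous _ _)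
  have hconv : ∀ g : α → ℝ≥0∞, AEMeasurable g μ →
      ∫⁻ y, g y ∂ν = ∫⁻ y, ENNReal.ofReal (φ y) * g y ∂μ := fun g hg =>
    lintegral_withDensity_eq_lintegral_mul₀ hρ.aemeasurable hg
  have h1 : ‖∫ y, φ y • h y ∂μ‖ₑ ≤ eLpNorm h 1 ν := by
    rw [eLpNorm_one_eq_lintegral_enorm, hconv _ hh.enorm]
    refine (enorm_integral_le_lintegral_enorm _).trans (le_of_eq (lintegral_congr fun y => ?_))
    rw [enorm_smul, Real.enorm_of_nonneg (hφ0 y)]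
  calc ‖∫ y, φ y • h y ∂μ‖ₑ ^ 2 ≤ eLpNorm h 2 ν ^ 2 := by
        gcongr
        exact h1.trans (eLpNorm_le_eLpNorm_of_exponent_le one_le_two hhν)
    _ = _ := by rw [eLpNorm_two_sq, hconv _ (hh.enorm.pow_const 2)]

variable {d : ℕ}

/-- `‖φ ∗ v - v‖` is at most the supremum of `‖v(· - y) - v‖` over the support of a probability
density `φ`: apply the Cauchy–Schwarz inequality at each point and exchange the integrals. -/
theorem eLpNorm_convolution_sub_le {φ : EuclideanSpace ℝ (Fin d) → ℝ} (hφc : Continuous φ)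
    (hφs : HasCompactSupport φ) (hφ0 : ∀ y, 0 ≤ φ y) (hφ1 : ∫ y, φ y = 1) (v : L2 d) {C : ℝ≥0∞}
    (hC : ∀ y, φ y ≠ 0 → eLpNorm (fun x => v (x - y) - v x) 2 volume ≤ C) :
    eLpNorm (convolution φ v (ContinuousLinearMap.lsmul ℝ ℝ) volume - ⇑v) 2 volume ≤ C := by
  have hv : Measurable v := (Lp.stronglyMeasurable v).measurable
  have hvl : LocallyIntegrable v volume := (Lp.memLp v).locallyIntegrable one_le_two
  have hφi : Integrable φ := hφc.integrable_of_hasCompactSupport hφs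
  have hmeas : Measurable fun p : EuclideanSpace ℝ (Fin d) × EuclideanSpace ℝ (Fin d) =>
      ENNReal.ofReal (φ p.2) * ‖v (p.1 - p.2) - v p.1‖ₑ ^ 2 := by
    have := hφc.measurable
    fun_prop
  have hpt : ∀ x, ‖(convolution φ v (ContinuousLinearMap.lsmul ℝ ℝ) volume - ⇑v) x‖ₑ ^ 2
      ≤ ∫⁻ y, ENNReal.ofReal (φ y) * ‖v (x - y) - v x‖ₑ ^ 2 := by
    intro x
    have hex : Integrable fun y => φ y • v (x - y) :=
      hφs.convolutionExists_left (ContinuousLinearMap.lsmul ℝ ℝ) hφc hvl x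
    have heq : (convolution φ v (ContinuousLinearMap.lsmul ℝ ℝ) volume - ⇑v) x
        = ∫ y, φ y • (v (x - y) - v x) := by
      simp_rw [smul_sub]
      rw [integral_sub hex (hφi.smul_const _), integral_smul_const, hφ1, one_smul]
      rfl
    rw [heq]
    refine enorm_integral_density_smul_sq_le hφc.measurable hφ0 hφi hφ1 ?_
    exact Measurable.aestronglyMeasurable (by fun_prop)
  rw [← ENNReal.pow_le_pow_left_iff two_ne_zero, eLpNorm_two_sq]
  calc _ ≤ ∫⁻ x, ∫⁻ y, ENNReal.ofReal (φ y) * ‖v (x - y) - v x‖ₑ ^ 2 := lintegral_mono hpt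
    _ = ∫⁻ y, ∫⁻ x, ENNReal.ofReal (φ y) * ‖v (x - y) - v x‖ₑ ^ 2 :=
      lintegral_lintegral_swap hmeas.aemeasurable
    _ ≤ ∫⁻ y, ENNReal.ofReal (φ y) * C ^ 2 := by
      refine lintegral_mono fun y => ?_
      rw [lintegral_const_mul _ (by fun_prop), ← eLpNorm_two_sq]
      by_cases hy : φ y = 0
      · simp [hy]
      · gcongr
        exact hC y hy
    _ = C ^ 2 := by
      rw [lintegral_mul_const _ hφc.measurable.ennreal_ofReal,
        ← ofReal_integral_eq_lintegral_ofReal hφi (ae_of_all _ hφ0), hφ1]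
      simp

theorem continuous_scaled {ψ : EuclideanSpace ℝ (Fin d) → ℝ} (hψ : Continuous ψ) (ε : ℝ) :
    Continuous (scaled ψ ε) := by
  unfold scaled; fun_prop

theorem hasCompactSupport_scaled {ψ : EuclideanSpace ℝ (Fin d) → ℝ} (hψ : HasCompactSupport ψ)
    {ε : ℝ} (hε : ε ≠ 0) : HasCompactSupport (scaled ψ ε) :=
  (hψ.comp_smul (inv_ne_zero hε)).mul_left

theorem integral_scaled (ψ : EuclideanSpace ℝ (Fin d) → ℝ) {ε : ℝ} (hε : 0 < ε) :
    ∫ y, scaled ψ ε y = ∫ y, ψ y := by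
  simp only [scaled]
  rw [integral_const_mul, Measure.integral_comp_inv_smul_of_nonneg _ _ hε.le]
  simp only [finrank_euclideanSpace, Fintype.card_fin, smul_eq_mul]
  rw [inv_mul_cancel_left₀ (pow_pos hε d).ne']

/-- The translate `x ↦ v (x - y)` of an element of `L²`. -/
noncomputable def translate (y : EuclideanSpace ℝ (Fin d)) (v : L2 d) : L2 d :=
  Lp.compMeasurePreserving (fun x => x - y) (measurePreserving_sub_right volume y) v

theorem coeFn_translate_sub (y : EuclideanSpace ℝ (Fin d)) (v : L2 d) :
    (translate y v - v : L2 d) =ᵐ[volume] fun x => v (x - y) - v x := by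
  filter_upwards [Lp.coeFn_sub (translate y v) v,
    Lp.coeFn_compMeasurePreserving v (measurePreserving_sub_right volume y)] with x h1 h2
  rw [h1, Pi.sub_apply, translate, h2, Function.comp_apply]

theorem translate_zero (v : L2 d) : translate 0 v = v := by
  refine sub_eq_zero.1 (Lp.ext ((coeFn_translate_sub 0 v).trans ?_))
  filter_upwards [Lp.coeFn_zero ℂ 2 (volume : Measure (EuclideanSpace ℝ (Fin d)))] with x hx
  rw [sub_zero, sub_self, hx, Pi.zero_apply]

theorem continuous_translate :
    Continuous fun p : EuclideanSpace ℝ (Fin d) × L2 d => translate p.1 p.2 := by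
  let g : C(EuclideanSpace ℝ (Fin d), C(EuclideanSpace ℝ (Fin d), EuclideanSpace ℝ (Fin d))) :=
    ContinuousMap.curry ⟨fun p => p.2 - p.1, by fun_prop⟩
  exact continuous_snd.compMeasurePreservingLp (g.continuous.comp continuous_fst)
    (fun p => measurePreserving_sub_right volume p.1) ENNReal.ofNat_ne_top

/-- Translations converge to the identity uniformly on compact subsets of `L²`. -/
theorem eventually_eLpNorm_translate_sub_le {K : Set (L2 d)} (hK : IsCompact K) {δ : ℝ}
    (hδ : 0 < δ) :
    ∀ᶠ y in 𝓝 (0 : EuclideanSpace ℝ (Fin d)), ∀ v ∈ K,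
      eLpNorm (fun x => v (x - y) - v x) 2 volume ≤ ENNReal.ofReal δ := by
  have hcont : Continuous fun p : EuclideanSpace ℝ (Fin d) × L2 d => ‖translate p.1 p.2 - p.2‖ :=
    ((continuous_translate (d := d)).sub continuous_snd).norm
  have hnear : ∀ᶠ y in 𝓝 (0 : EuclideanSpace ℝ (Fin d)), ∀ v ∈ K, ‖translate y v - v‖ < δ := by
    refine hK.eventually_forall_of_forall_eventually fun v _ => ?_
    refine hcont.continuousAt.eventually_lt_const ?_
    change ‖translate 0 v - v‖ < δ
    rwa [translate_zero, sub_self, norm_zero]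
  filter_upwards [hnear] with y hy v hv
  rw [← eLpNorm_congr_ae (coeFn_translate_sub y v), ← Lp.enorm_def, ← ofReal_norm]
  exact ENNReal.ofReal_le_ofReal (hy v hv).le

/-- Mollification converges to the identity uniformly on compact subsets of `L²`. -/
theorem eventually_eLpNorm_mollify_sub_le {ψ : EuclideanSpace ℝ (Fin d) → ℝ}
    (hψ : IsFriedrichsMollifier ψ) {K : Set (L2 d)} (hK : IsCompact K) {δ : ℝ} (hδ : 0 < δ) :
    ∀ᶠ ε in 𝓝[>] (0 : ℝ), ∀ v ∈ K,
      eLpNorm (mollify ψ ε v - ⇑v) 2 volume ≤ ENNReal.ofReal δ := by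
  obtain ⟨ρ, hρ, hball⟩ := Metric.eventually_nhds_iff.1 (eventually_eLpNorm_translate_sub_le hK hδ)
  obtain ⟨R, hR⟩ := hψ.hasCompactSupport.isCompact.isBounded.exists_norm_le
  have hsmall : ∀ᶠ ε in 𝓝[>] (0 : ℝ), ε * R < ρ := by
    have : Tendsto (fun ε : ℝ => ε * R) (𝓝[>] 0) (𝓝 (0 * R)) :=
      (tendsto_id.mul_const R).mono_left nhdsWithin_le_nhds
    rw [zero_mul] at this
    exact this.eventually_lt_const hρ
  filter_upwards [hsmall, self_mem_nhdsWithin] with ε hε (hε0 : 0 < ε) v hv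
  refine eLpNorm_convolution_sub_le (continuous_scaled hψ.contDiff.continuous ε)
    (hasCompactSupport_scaled hψ.hasCompactSupport hε0.ne')
    (fun y => mul_nonneg (by positivity) (hψ.nonneg _))
    ((integral_scaled ψ hε0).trans hψ.integral_eq_one) v fun y hy => hball ?_ v hv
  have hy' : ψ (ε⁻¹ • y) ≠ 0 := right_ne_zero_of_mul hy
  have h := hR _ (subset_tsupport ψ hy')
  rw [norm_smul, norm_inv, Real.norm_of_nonneg hε0.le, inv_mul_le_iff₀ hε0] at h
  rw [dist_zero_right]
  exact h.trans_lt hε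

theorem continuous_mollify {F : Type*} [NormedAddCommGroup F] [NormedSpace ℝ F]
    {ψ : EuclideanSpace ℝ (Fin d) → ℝ} (hψ : IsFriedrichsMollifier ψ) {ε : ℝ} (hε : ε ≠ 0)
    {g : EuclideanSpace ℝ (Fin d) → F} (hg : LocallyIntegrable g volume) :
    Continuous (mollify ψ ε g) :=
  (hasCompactSupport_scaled hψ.hasCompactSupport hε).continuous_convolution_left _
    (continuous_scaled hψ.contDiff.continuous ε) hg

/-! ### Linearity of the fractional Laplacian -/

theorem fracSymbol_mul_fourier_sub_ae (σ : ℝ) (f g : L2 d) :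
    (fun ξ => (fracSymbol σ ξ : ℂ) * (𝓕 (f - g) : L2 d) ξ) =ᵐ[volume]
      (fun ξ => (fracSymbol σ ξ : ℂ) * (𝓕 f : L2 d) ξ)
        - fun ξ => (fracSymbol σ ξ : ℂ) * (𝓕 g : L2 d) ξ := by
  have h : (𝓕 (f - g) : L2 d) = 𝓕 f - 𝓕 g :=
    map_sub (Lp.fourierTransformₗᵢ (EuclideanSpace ℝ (Fin d)) ℂ) f g
  rw [h]
  filter_upwards [Lp.coeFn_sub (𝓕 f : L2 d) (𝓕 g)] with ξ hξ
  rw [hξ, Pi.sub_apply, Pi.sub_apply, mul_sub]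

theorem FracLapMemL2.sub {σ : ℝ} {f g : L2 d} (hf : FracLapMemL2 σ f) (hg : FracLapMemL2 σ g) :
    FracLapMemL2 σ (f - g) :=
  (memLp_congr_ae (fracSymbol_mul_fourier_sub_ae σ f g)).2 (MemLp.sub hf hg)

theorem fracLap_sub {σ : ℝ} {f g : L2 d} (hf : FracLapMemL2 σ f) (hg : FracLapMemL2 σ g) :
    fracLap σ (f - g) = fracLap σ f - fracLap σ g := by
  have h : (hf.sub hg).toLp _ = hf.toLp _ - hg.toLp _ :=
    (MemLp.toLp_congr (hf.sub hg) (MemLp.sub hf hg) (fracSymbol_mul_fourier_sub_ae σ f g)).trans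
      (MemLp.toLp_sub hf hg)
  rw [fracLap, fracLap, fracLap, dif_pos (hf.sub hg), dif_pos hf, dif_pos hg, h]
  exact map_sub (Lp.fourierTransformₗᵢ (EuclideanSpace ℝ (Fin d)) ℂ).symm _ _

/-! ### Multiplication by bounded coefficients -/

/-- The space `L^∞(ℝᵈ)` of (classes of) real coefficients. -/
abbrev LInfty (d : ℕ) : Type := Lp ℝ ∞ (volume : Measure (EuclideanSpace ℝ (Fin d)))

/-- Multiplication by a bounded real function, as a bounded operator on `L²`. -/
noncomputable def mulOp : LInfty d →L[ℝ] L2 d →L[ℝ] L2 d :=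
  (ContinuousLinearMap.lsmul ℝ ℝ : ℝ →L[ℝ] ℂ →L[ℝ] ℂ).holderL volume ∞ 2 2

theorem norm_mulOp_le (M : LInfty d) : ‖mulOp M‖ ≤ ‖M‖ := by
  refine ContinuousLinearMap.opNorm_le_bound _ (norm_nonneg _) fun v => ?_
  refine (ContinuousLinearMap.norm_holder_apply_apply_le
    (ContinuousLinearMap.lsmul ℝ ℝ : ℝ →L[ℝ] ℂ →L[ℝ] ℂ) M v).trans ?_
  have h := ContinuousLinearMap.opNorm_lsmul_le (𝕜 := ℝ) (R := ℝ) (E := ℂ)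
  calc _ ≤ 1 * ‖M‖ * ‖v‖ := by gcongr
    _ = ‖M‖ * ‖v‖ := by rw [one_mul]

theorem coeFn_mulOp (M : LInfty d) (v : L2 d) :
    mulOp M v =ᵐ[volume] fun x => (M x : ℂ) * v x := by
  filter_upwards [ContinuousLinearMap.coeFn_holder (r := 2)
    (ContinuousLinearMap.lsmul ℝ ℝ : ℝ →L[ℝ] ℂ →L[ℝ] ℂ) M v] with x hx
  refine hx.trans ?_
  simp

theorem integral_conj_mul_eq_inner (φ F : L2 d) {g : EuclideanSpace ℝ (Fin d) → ℂ}
    (h : F =ᵐ[volume] g) : ∫ x, conj (φ x) * g x = inner ℂ φ F := by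
  rw [L2.inner_def]
  refine integral_congr_ae ?_
  filter_upwards [h] with x hx
  rw [hx, RCLike.inner_apply, mul_comm]

/-! ### Stability of solutions -/

/-- The coefficients, the source and the initial data matter only up to null sets. -/
theorem IsSolution.congr_ae {T s : ℝ} {m b m' b' : EuclideanSpace ℝ (Fin d) → ℝ}
    {f f' : ℝ → EuclideanSpace ℝ (Fin d) → ℂ} {u₀ u₁ u₀' u₁' : EuclideanSpace ℝ (Fin d) → ℂ}
    {u : ℝ → L2 d} (hu : IsSolution T s m b f u₀ u₁ u) (hm : m' =ᵐ[volume] m)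
    (hb : b' =ᵐ[volume] b) (hf : ∀ t ∈ Icc 0 T, f' t =ᵐ[volume] f t)
    (h0 : u₀' =ᵐ[volume] u₀) (h1 : u₁' =ᵐ[volume] u₁) : IsSolution T s m' b' f' u₀' u₁' u where
  memHs := hu.memHs
  continuousOn := hu.continuousOn
  continuousOn_fracLap := hu.continuousOn_fracLap
  contDiffOn := hu.contDiffOn
  initial := hu.initial.trans h0.symm
  initial_timeDeriv := hu.initial_timeDeriv.trans h1.symm
  equation φ hφ t ht := by
    have e1 : ∫ x, conj (φ x) * f' t x = ∫ x, conj (φ x) * f t x := by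
      refine integral_congr_ae ?_
      filter_upwards [hf t ht] with x hx
      rw [hx]
    have e2 : ∫ x, conj (φ x) * ((m' x : ℂ) * u t x + (b' x : ℂ) * timeDeriv T u t x)
        = ∫ x, conj (φ x) * ((m x : ℂ) * u t x + (b x : ℂ) * timeDeriv T u t x) := by
      refine integral_congr_ae ?_
      filter_upwards [hm, hb] with x hx hx'
      rw [hx, hx']
    rw [e1, e2]
    exact hu.equation φ hφ t ht

section Stability

variable {T s : ℝ} {M B : LInfty d} {f : ℝ → L2 d} {u₀ u₁ : L2 d} {u : ℝ → L2 d}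

/-- The weak equation with all integrals written as inner products of `L²`. -/
theorem IsSolution.hasDerivWithinAt_inner (hu : IsSolution T s M B (fun t => f t) u₀ u₁ u)
    {φ : L2 d} (hφ : MemHs s φ) {t : ℝ} (ht : t ∈ Icc 0 T) :
    HasDerivWithinAt (fun τ => inner ℂ φ (timeDeriv T u τ))
      (inner ℂ φ (f t) - inner ℂ (fracLap (s / 2) φ) (fracLap (s / 2) (u t))
        - inner ℂ φ (mulOp M (u t) + mulOp B (timeDeriv T u t))) (Icc 0 T) t := by
  have h := hu.equation φ hφ t ht
  rwa [integral_conj_mul_eq_inner φ (f t) (EventuallyEq.refl _ _),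
    integral_conj_mul_eq_inner φ (mulOp M (u t) + mulOp B (timeDeriv T u t))] at h
  filter_upwards [Lp.coeFn_add (mulOp M (u t)) (mulOp B (timeDeriv T u t)),
    coeFn_mulOp M (u t), coeFn_mulOp B (timeDeriv T u t)] with x h1 h2 h3
  rw [h1, Pi.add_apply, h2, h3]

theorem IsSolution.hasDerivWithinAt {m b : EuclideanSpace ℝ (Fin d) → ℝ}
    {f : ℝ → EuclideanSpace ℝ (Fin d) → ℂ} {u₀ u₁ : EuclideanSpace ℝ (Fin d) → ℂ}
    (hu : IsSolution T s m b f u₀ u₁ u) {t : ℝ} (ht : t ∈ Icc 0 T) :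
    HasDerivWithinAt u (timeDeriv T u t) (Icc 0 T) t :=
  (hu.contDiffOn.differentiableOn one_ne_zero t ht).hasDerivWithinAt

theorem IsSolution.exists_norm_le (hT : 0 < T) {m b : EuclideanSpace ℝ (Fin d) → ℝ}
    {f : ℝ → EuclideanSpace ℝ (Fin d) → ℂ} {u₀ u₁ : EuclideanSpace ℝ (Fin d) → ℂ}
    (hu : IsSolution T s m b f u₀ u₁ u) :
    ∃ U, ∀ t ∈ Icc 0 T, ‖u t‖ ≤ U ∧ ‖timeDeriv T u t‖ ≤ U := by
  obtain ⟨U₁, h₁⟩ := isCompact_Icc.exists_bound_of_continuousOn hu.continuousOn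
  obtain ⟨U₂, h₂⟩ := isCompact_Icc.exists_bound_of_continuousOn
    (hu.contDiffOn.continuousOn_derivWithin (uniqueDiffOn_Icc hT) le_rfl)
  exact ⟨max U₁ U₂, fun t ht => ⟨(h₁ t ht).trans (le_max_left _ _),
    (h₂ t ht).trans (le_max_right _ _)⟩⟩

variable {M' B' : LInfty d} {f' : ℝ → L2 d} {u₀' u₁' : L2 d} {u' : ℝ → L2 d}

/-- Lipschitz dependence in `L²` of the solution on coefficients, source and initial data. The
bound `U` on the unprimed solution enters because the perturbation of the coefficients acts on
it. -/
theorem IsSolution.norm_sub_sq_le (hT : 0 < T)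
    (hu : IsSolution T s M B (fun t => f t) u₀ u₁ u)
    (hu' : IsSolution T s M' B' (fun t => f' t) u₀' u₁' u') {η μ β U : ℝ}
    (hμ : ‖M'‖ ≤ μ) (hβ : ‖B'‖ ≤ β) (hM : ‖M' - M‖ ≤ η) (hB : ‖B' - B‖ ≤ η)
    (hf : ∀ t ∈ Icc 0 T, ‖f' t - f t‖ ≤ η) (h0 : ‖u₀' - u₀‖ ≤ η) (h1 : ‖u₁' - u₁‖ ≤ η)
    (hU : ∀ t ∈ Icc 0 T, ‖u t‖ ≤ U ∧ ‖timeDeriv T u t‖ ≤ U) {t : ℝ} (ht : t ∈ Icc 0 T) :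
    ‖u' t - u t‖ ^ 2 ≤ η ^ 2 * ((1 + ((1 + 2 * U) * T + 1 + β) ^ 2)
      * Real.exp ((2 + μ + 2 * β) * T)) := by
  have hη : 0 ≤ η := (norm_nonneg _).trans hM
  have hβ0 : 0 ≤ β := (norm_nonneg _).trans hβ
  have h0T : (0 : ℝ) ∈ Icc 0 T := ⟨le_rfl, hT.le⟩
  have hU0 : 0 ≤ U := (norm_nonneg _).trans (hU 0 h0T).1
  have hini : u' 0 - u 0 = u₀' - u₀ := by
    rw [Lp.ext hu'.initial, Lp.ext hu.initial]
  have hini1 : timeDeriv T u' 0 - timeDeriv T u 0 = u₁' - u₁ := by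
    rw [Lp.ext hu'.initial_timeDeriv, Lp.ext hu.initial_timeDeriv]
  have key := energy_estimate (w := fun t => u' t - u t)
    (w' := fun t => timeDeriv T u' t - timeDeriv T u t)
    (a := fun t => fracLap (s / 2) (u' t) - fracLap (s / 2) (u t)) (γ := η * (1 + 2 * U))
    hT.le (fun t ht => (hu'.hasDerivWithinAt ht).sub (hu.hasDerivWithinAt ht))
    (hu'.continuousOn_fracLap.sub hu.continuousOn_fracLap) (mulOp M') (mulOp B')
    ((norm_mulOp_le M').trans hμ) ((norm_mulOp_le B').trans hβ) ?_ ht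
  · simp only [hini, hini1] at key
    refine key.trans ?_
    rw [← mul_assoc]
    gcongr
    calc ‖u₀' - u₀‖ ^ 2 + (η * (1 + 2 * U) * T + ‖u₁' - u₁‖ + β * ‖u₀' - u₀‖) ^ 2
        ≤ η ^ 2 + (η * (1 + 2 * U) * T + η + β * η) ^ 2 := by gcongr
      _ = η ^ 2 * (1 + ((1 + 2 * U) * T + 1 + β) ^ 2) := by ring
  · intro r hr t ht
    have hmem : MemHs s (u' r - u r) := FracLapMemL2.sub (hu'.memHs r hr) (hu.memHs r hr)
    have hlap : fracLap (s / 2) (u' r - u r) = fracLap (s / 2) (u' r) - fracLap (s / 2) (u r) :=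
      fracLap_sub (hu'.memHs r hr) (hu.memHs r hr)
    have h := (hu'.hasDerivWithinAt_inner hmem ht).sub (hu.hasDerivWithinAt_inner hmem ht)
    refine ⟨_, h.congr (fun τ _ => inner_sub_right _ _ _) (inner_sub_right _ _ _), ?_⟩
    -- The terms with `A` cancel; what remains is the source of the equation for `u' - u`.
    have hz : inner ℂ (u' r - u r) (f' t)
          - inner ℂ (fracLap (s / 2) (u' r - u r)) (fracLap (s / 2) (u' t))
          - inner ℂ (u' r - u r) (mulOp M' (u' t) + mulOp B' (timeDeriv T u' t))
          - (inner ℂ (u' r - u r) (f t)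
          - inner ℂ (fracLap (s / 2) (u' r - u r)) (fracLap (s / 2) (u t))
          - inner ℂ (u' r - u r) (mulOp M (u t) + mulOp B (timeDeriv T u t)))
          + inner ℂ (fracLap (s / 2) (u' r) - fracLap (s / 2) (u r))
              (fracLap (s / 2) (u' t) - fracLap (s / 2) (u t))
          + inner ℂ (u' r - u r)
              (mulOp M' (u' t - u t) + mulOp B' (timeDeriv T u' t - timeDeriv T u t))
        = inner ℂ (u' r - u r) (f' t - f t - mulOp (M' - M) (u t)
            - mulOp (B' - B) (timeDeriv T u t)) := by
      rw [← hlap]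
      simp only [map_sub, _root_.sub_apply, inner_sub_right, inner_add_right]
      ring
    rw [hz]
    have hg : ‖f' t - f t - mulOp (M' - M) (u t) - mulOp (B' - B) (timeDeriv T u t)‖
        ≤ η * (1 + 2 * U) := by
      have a1 := (mulOp (M' - M)).le_of_opNorm_le_of_le ((norm_mulOp_le _).trans hM) (hU t ht).1
      have a2 := (mulOp (B' - B)).le_of_opNorm_le_of_le ((norm_mulOp_le _).trans hB) (hU t ht).2
      calc _ ≤ ‖f' t - f t‖ + ‖mulOp (M' - M) (u t)‖ + ‖mulOp (B' - B) (timeDeriv T u t)‖ :=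
            (norm_sub_le _ _).trans (by gcongr; exact norm_sub_le _ _)
        _ ≤ η + η * U + η * U := by gcongr; exact hf t ht
        _ = _ := by ring
    calc _ ≤ ‖u' r - u r‖ * ‖f' t - f t - mulOp (M' - M) (u t)
            - mulOp (B' - B) (timeDeriv T u t)‖ := norm_inner_le_norm _ _
      _ ≤ ‖u' r - u r‖ * (η * (1 + 2 * U)) := by gcongr
      _ = _ := mul_comm _ _

end Stability

/-! ### Convergence of the regularised solutions -/

theorem exists_Lp_norm_sub_le {α F : Type*} [MeasurableSpace α] [NormedAddCommGroup F]
    {μ : Measure α} {p : ℝ≥0∞} (v : Lp F p μ) {g : α → F}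
    (hg : AEStronglyMeasurable g μ) {δ : ℝ} (hδ : 0 ≤ δ)
    (h : eLpNorm (g - ⇑v) p μ ≤ ENNReal.ofReal δ) :
    ∃ G : Lp F p μ, G =ᵐ[μ] g ∧ ‖G - v‖ ≤ δ := by
  have hsub : MemLp (g - ⇑v) p μ :=
    ⟨hg.sub (Lp.aestronglyMeasurable v), h.trans_lt ENNReal.ofReal_lt_top⟩
  have hGv : MemLp g p μ := by simpa using hsub.add (Lp.memLp v)
  refine ⟨hGv.toLp g, hGv.coeFn_toLp, ?_⟩
  rw [Lp.norm_def]
  refine ENNReal.toReal_le_of_le_ofReal hδ ?_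
  rwa [eLpNorm_congr_ae ((Lp.coeFn_sub _ _).trans (hGv.coeFn_toLp.sub (EventuallyEq.refl _ _)))]

end FracWave

theorem theorem5p1 {d : ℕ} (hd : 0 < d) {T s : ℝ} (hT : 0 < T) (hs : 0 < s)
    (ψ : EuclideanSpace ℝ (Fin d) → ℝ) (hψ : FracWave.IsFriedrichsMollifier ψ)
    (m b : EuclideanSpace ℝ (Fin d) → ℝ)
    (hm : MemLp m ∞ volume) (hb : MemLp b ∞ volume)
    (hm0 : ∀ᵐ x, 0 ≤ m x) (hb0 : ∀ᵐ x, 0 ≤ b x)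
    (f : ℝ → FracWave.L2 d) (hf : ContinuousOn f (Icc 0 T))
    (u₀ u₁ : FracWave.L2 d) (hu₀ : FracWave.MemHs s u₀)
    -- `u` is the classical solution
    (u : ℝ → FracWave.L2 d)
    (hu : FracWave.IsSolution T s m b (fun t => f t) u₀ u₁ u)
    -- the regularised coefficients converge in the sup norm
    (hmε : Tendsto (fun ε => eLpNorm (FracWave.mollify ψ ε m - m) ∞ volume) (𝓝[>] 0) (𝓝 0))
    (hbε : Tendsto (fun ε => eLpNorm (FracWave.mollify ψ ε b - b) ∞ volume) (𝓝[>] 0) (𝓝 0))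
    -- `uε ε`, for `ε ∈ (0, 1]`, solves the regularised problem
    (uε : ℝ → ℝ → FracWave.L2 d)
    (huε : ∀ ε ∈ Ioc (0 : ℝ) 1,
      FracWave.IsSolution T s (FracWave.mollify ψ ε m) (FracWave.mollify ψ ε b)
        (fun t => FracWave.mollify ψ ε (f t)) (FracWave.mollify ψ ε u₀)
        (FracWave.mollify ψ ε u₁) (uε ε)) :
    TendstoUniformlyOn uε u (𝓝[>] 0) (Icc 0 T) := by
  open FracWave in
  rw [Metric.tendstoUniformlyOn_iff]
  intro δ hδ
  let M : LInfty d := hm.toLp m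
  let B : LInfty d := hb.toLp b
  have hMm : M =ᵐ[volume] m := hm.coeFn_toLp
  have hBb : B =ᵐ[volume] b := hb.coeFn_toLp
  have hu' : IsSolution T s M B (fun t => f t) u₀ u₁ u :=
    hu.congr_ae hMm hBb (fun _ _ => EventuallyEq.rfl) EventuallyEq.rfl EventuallyEq.rfl
  obtain ⟨U, hU⟩ := hu.exists_norm_le hT
  set C : ℝ := (1 + ((1 + 2 * U) * T + 1 + (‖B‖ + 1)) ^ 2)
    * Real.exp ((2 + (‖M‖ + 1) + 2 * (‖B‖ + 1)) * T) with hC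
  have hC0 : 0 < C := by positivity
  -- `η` is the size of the perturbation of the data for which the stability estimate gives `δ`;
  -- `η ≤ 1` keeps the regularised coefficients below `‖M‖ + 1` and `‖B‖ + 1`.
  obtain ⟨η, hη, hη1, hηC⟩ : ∃ η : ℝ, 0 < η ∧ η ≤ 1 ∧ η ^ 2 * C < δ ^ 2 := by
    have hlim : Tendsto (fun η : ℝ => η ^ 2 * C) (𝓝[>] 0) (𝓝 0) := by
      have : Continuous fun η : ℝ => η ^ 2 * C := by fun_prop
      simpa using (this.tendsto 0).mono_left (nhdsWithin_le_nhds (s := Ioi 0))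
    obtain ⟨η, h1, h2⟩ := ((hlim.eventually_lt_const (pow_pos hδ 2)).and
      (Ioc_mem_nhdsGT (zero_lt_one' ℝ))).exists
    exact ⟨η, h2.1, h2.2, h1⟩
  have hη' : 0 < ENNReal.ofReal η := ENNReal.ofReal_pos.2 hη
  have hK : IsCompact (f '' Icc 0 T ∪ {u₀, u₁}) :=
    (isCompact_Icc.image_of_continuousOn hf).union (toFinite {u₀, u₁}).isCompact
  filter_upwards [eventually_eLpNorm_mollify_sub_le hψ hK hη, hmε.eventually_lt_const hη',
    hbε.eventually_lt_const hη', Ioc_mem_nhdsGT (zero_lt_one' ℝ)] with ε hε hmε hbε hε01 t ht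
  have hε0 : ε ≠ 0 := hε01.1.ne'
  have hL2 : ∀ v ∈ f '' Icc 0 T ∪ {u₀, u₁},
      ∃ G : L2 d, G =ᵐ[volume] mollify ψ ε v ∧ ‖G - v‖ ≤ η := fun v hv =>
    exists_Lp_norm_sub_le v (continuous_mollify hψ hε0
      ((Lp.memLp v).locallyIntegrable one_le_two)).aestronglyMeasurable hη.le (hε v hv)
  have hLinf : ∀ {g : EuclideanSpace ℝ (Fin d) → ℝ} (hg : MemLp g ∞ volume),
      eLpNorm (mollify ψ ε g - g) ∞ volume < ENNReal.ofReal η →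
      ∃ G : LInfty d, G =ᵐ[volume] mollify ψ ε g ∧ ‖G - hg.toLp g‖ ≤ η := fun {g} hg h =>
    exists_Lp_norm_sub_le (hg.toLp g) (continuous_mollify hψ hε0
      (hg.locallyIntegrable le_top)).aestronglyMeasurable hη.le (by
        rw [eLpNorm_congr_ae ((EventuallyEq.refl _ _).sub hg.coeFn_toLp)]
        exact h.le)
  obtain ⟨M', hM'm, hM'⟩ := hLinf hm hmε
  obtain ⟨B', hB'b, hB'⟩ := hLinf hb hbε
  choose! G hG hGη using hL2
  have hfK : ∀ t ∈ Icc 0 T, f t ∈ f '' Icc 0 T ∪ {u₀, u₁} := fun t ht =>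
    Or.inl (mem_image_of_mem f ht)
  have h0K : u₀ ∈ f '' Icc 0 T ∪ {u₀, u₁} := Or.inr (Or.inl rfl)
  have h1K : u₁ ∈ f '' Icc 0 T ∪ {u₀, u₁} := Or.inr (Or.inr rfl)
  have huε' : IsSolution T s M' B' (fun t => G (f t)) (G u₀) (G u₁) (uε ε) :=
    (huε ε hε01).congr_ae hM'm hB'b (fun t ht => hG _ (hfK t ht)) (hG _ h0K) (hG _ h1K)
  have hnorm : ∀ {P P' : LInfty d}, ‖P' - P‖ ≤ η → ‖P'‖ ≤ ‖P‖ + 1 := fun {P P'} h =>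
    (norm_le_norm_add_norm_sub' P' P).trans (by linarith)
  have hsq := hu'.norm_sub_sq_le hT huε' (hnorm hM') (hnorm hB') hM' hB'
    (fun t ht => hGη _ (hfK t ht)) (hGη _ h0K) (hGη _ h1K) hU ht
  rw [dist_comm, dist_eq_norm]
  exact lt_of_pow_lt_pow_left₀ 2 hδ.le (hsq.trans_lt hηC)
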